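/- For a finite group $G$ let $L(G)$ be the set of its subgroups and, for $H\in L(G)$, let $$sd(H,G)=\frac{|\{(H_1,G_1)\in L(H)\times L(G) : H_1G_1=G_1H_1\}|}{|L(H)|\,|L(G)|}.$$ Let $\mathcal C$ be the class of all finite groups $G$ for which the function $f\colon L(G)\to[0,1]$, $f(H)=sd(H,G)$, takes exactly two values, i.e. $|\operatorname{Im} f|=2$. Then none of the following groups belongs to $\mathcal C$: - the dihedral groups $D_{2^n}=\langle x,y \mid x^{2^{n-1}}=y^2=1,\ yxy^{-1}=x^{-1}\rangle$ of order $2^n$, $n\ge 3$; - the generalized quaternion groups $Q_{2^n}=\langle x,y \mid x^{2^{n-1}}=1,\ y^2=x^{2^{n-2}},\ yxy^{-1}=x^{-1}\rangle$ of order $2^n$, $n\ge 3$; - the quasi-dihedral groups $S_{2^n}=\langle x,y \mid x^{2^{n-1}}=y^2=1,\ y^{-1}xy=x^{2^{n-2}-1}\rangle$ of order $2^n$, $n\ge 4$. -/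

import Mathlib

open scoped Pointwise

/-- The pairs `(H₁, G₁)` of subgroups of `G` with `H₁ ≤ H` and `H₁ G₁ = G₁ H₁` as sets of products.
The subgroups of `H` are represented as the subgroups of `G` contained in `H`. -/
def permutingPairs {G : Type*} [Group G] (H : Subgroup G) : Set (Subgroup G × Subgroup G) :=
  {p | p.1 ≤ H ∧ (p.1 : Set G) * (p.2 : Set G) = (p.2 : Set G) * (p.1 : Set G)}

/-- The relative subgroup commutativity degree `sd(H, G)` of a subgroup `H` of a finite group `G`:
the proportion of permuting pairs in `L(H) × L(G)`. -/
noncomputable def relSubgroupCommDegree {G : Type*} [Group G] (H : Subgroup G) : ℚ :=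
  ((permutingPairs H).ncard : ℚ) /
    (((Set.Iic H).ncard : ℚ) * (Nat.card (Subgroup G) : ℚ))

/-- Membership of `G` in the class `𝒞`: `G` is a finite group, and the function
`f : L(G) → [0, 1]`, `f(H) = sd(H, G)`, takes exactly two values. -/
def InClassC (G : Type*) [Group G] : Prop :=
  Finite G ∧
    (Set.range (relSubgroupCommDegree : Subgroup G → ℚ)).ncard = 2

/-- The relators of the quasi-dihedral group of order `2 ^ n`, in the generators `x = of 0` and
`y = of 1`: `x ^ (2 ^ (n - 1)) = 1`, `y ^ 2 = 1` and `y⁻¹ x y = x ^ (2 ^ (n - 2) - 1)`. -/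
def quasiDihedralRels (n : ℕ) : Set (FreeGroup (Fin 2)) :=
  {FreeGroup.of 0 ^ (2 ^ (n - 1)),
   FreeGroup.of 1 ^ 2,
   (FreeGroup.of 1)⁻¹ * FreeGroup.of 0 * FreeGroup.of 1 *
     (FreeGroup.of 0 ^ (2 ^ (n - 2) - 1))⁻¹}

/-- The quasi-dihedral group
`⟨x, y | x ^ (2 ^ (n - 1)) = y ^ 2 = 1, y⁻¹ x y = x ^ (2 ^ (n - 2) - 1)⟩`
of order `2 ^ n` (to be used for `4 ≤ n`). -/
abbrev QuasiDihedralGroup (n : ℕ) : Type := PresentedGroup (quasiDihedralRels n)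

/-! Count the pairs `(K, L)` with `K ≤ H` that do not permute: `sd(H, G) = 1` exactly when there are
none, as for `H = ⊥`. So in a group of class `𝒞` the number of such pairs is a fixed multiple of
`|L(H)|` over all `H` that have one. If the bad pairs of `H` are the disjoint union of those of `B`
and `C`, then `|L(H)| = |L(B)| + |L(C)|` (`InClassC.ncard_Iic_eq_add`), and the groups are excluded
by violating this equality.

In `not_inClassC_of_parity`, `B`, `C` and `⟨x⟩` are the three kernels of parity characters. Every
subgroup is `⊤`, `⟨x⟩`, or lies in `B` or `C`; the first two and all subgroups of `Φ = B ⊓ C ≤ ⟨x⟩`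
are normal, so bad pairs split between `B` and `C`. Equality then forces `|L(Φ)| = 2`, while `⊥ < ⟨x
^ 4⟩ < ⟨x ^ 2⟩ ≤ Φ`. This needs `x ^ 4 ≠ 1`, so order 8 is separate: a Klein four-subgroup serves
for the dihedral group, and the quaternion group has only normal subgroups. -/

/-! ### Counting non-permuting pairs -/

section Permuting

variable {G : Type*} [Group G]

/-- The pairs `(K, L)` of subgroups with `K ≤ H` that do not permute. -/
def nonPermutingPairs (H : Subgroup G) : Set (Subgroup G × Subgroup G) :=
  {p | p.1 ≤ H ∧ (p.1 : Set G) * (p.2 : Set G) ≠ (p.2 : Set G) * (p.1 : Set G)}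

theorem Subgroup.Normal.coe_mul_comm {K : Subgroup G} (hK : K.Normal) (L : Subgroup G) :
    (K : Set G) * (L : Set G) = (L : Set G) * (K : Set G) := by
  ext g
  simp only [Set.mem_mul, SetLike.mem_coe]
  constructor
  · rintro ⟨k, hk, l, hl, rfl⟩
    exact ⟨l, hl, l⁻¹ * k * l, by simpa using hK.conj_mem k hk l⁻¹, by group⟩
  · rintro ⟨l, hl, k, hk, rfl⟩
    exact ⟨l * k * l⁻¹, hK.conj_mem k hk l, l, hl, by group⟩

theorem nonPermutingPairs_eq_empty {H : Subgroup G} (h : ∀ K ≤ H, K.Normal) :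
    nonPermutingPairs H = ∅ := by
  ext p
  simp only [nonPermutingPairs, Set.mem_ofPred_eq, Set.mem_empty_iff_false, iff_false, not_and,
    not_not]
  exact fun hp => (h _ hp).coe_mul_comm _

theorem ncard_permutingPairs_add [Finite G] (H : Subgroup G) :
    (permutingPairs H).ncard + (nonPermutingPairs H).ncard =
      (Set.Iic H).ncard * Nat.card (Subgroup G) := by
  rw [← Set.ncard_union_eq, ← Set.ncard_univ, ← Set.ncard_prod]
  · congr 1
    ext p
    simp only [permutingPairs, nonPermutingPairs, Set.mem_union, Set.mem_ofPred_eq, Set.mem_prod,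
      Set.mem_Iic, Set.mem_univ]
    tauto
  · rw [Set.disjoint_left]
    exact fun p h h' => h'.2 h.2

theorem ncard_Iic_pos [Finite G] (H : Subgroup G) : 0 < (Set.Iic H).ncard :=
  (Set.ncard_pos).2 ⟨H, Set.mem_Iic.2 le_rfl⟩

theorem relSubgroupCommDegree_eq [Finite G] (H : Subgroup G) :
    relSubgroupCommDegree H = 1 - ((nonPermutingPairs H).ncard : ℚ) /
      (((Set.Iic H).ncard : ℚ) * (Nat.card (Subgroup G) : ℚ)) := by
  have h := ncard_permutingPairs_add H
  have h1 : ((Set.Iic H).ncard : ℚ) ≠ 0 := by exact_mod_cast (ncard_Iic_pos H).ne'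
  have h2 : (Nat.card (Subgroup G) : ℚ) ≠ 0 := by exact_mod_cast Nat.card_pos.ne'
  have h3 : ((permutingPairs H).ncard : ℚ) + (nonPermutingPairs H).ncard =
      (Set.Iic H).ncard * Nat.card (Subgroup G) := by exact_mod_cast h
  rw [relSubgroupCommDegree, eq_sub_iff_add_eq, ← add_div, h3, div_self (mul_ne_zero h1 h2)]

/-- In a group of class `𝒞` the subgroups `H` of relative commutativity degree different from `1`
all have the same ratio of non-permuting pairs to subgroups. -/
theorem InClassC.exists_ratio (h : InClassC G) :
    ∃ w : ℚ, ∀ H : Subgroup G, (nonPermutingPairs H).Nonempty →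
      w ≠ 0 ∧ ((nonPermutingPairs H).ncard : ℚ) = w * (Set.Iic H).ncard := by
  obtain ⟨hfin, hcard⟩ := h
  have h2 : (Nat.card (Subgroup G) : ℚ) ≠ 0 := by exact_mod_cast Nat.card_pos.ne'
  -- The value 1 is attained at `⊥`, so only one other value `v` is left.
  have hone : (1 : ℚ) ∈ Set.range (relSubgroupCommDegree : Subgroup G → ℚ) := by
    refine ⟨⊥, ?_⟩
    rw [relSubgroupCommDegree_eq, nonPermutingPairs_eq_empty]
    · simp
    · intro K hK
      rw [le_bot_iff.1 hK]
      infer_instance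
  obtain ⟨v, hv⟩ : ∃ v, ∀ H : Subgroup G, relSubgroupCommDegree H ≠ 1 →
      relSubgroupCommDegree H = v := by
    obtain ⟨a, b, -, hab⟩ := Set.ncard_eq_two.1 hcard
    have hmem : ∀ H : Subgroup G, relSubgroupCommDegree H = a ∨ relSubgroupCommDegree H = b := by
      intro H
      have : relSubgroupCommDegree H ∈ ({a, b} : Set ℚ) := hab ▸ Set.mem_range_self H
      simpa using this
    rw [hab] at hone
    rcases hone with rfl | hb
    · exact ⟨b, fun H hH => (hmem H).resolve_left hH⟩
    · obtain rfl : (1 : ℚ) = b := hb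
      exact ⟨a, fun H hH => (hmem H).resolve_right hH⟩
  refine ⟨(1 - v) * Nat.card (Subgroup G), fun H hH => ?_⟩
  have h1 : ((Set.Iic H).ncard : ℚ) ≠ 0 := by exact_mod_cast (ncard_Iic_pos H).ne'
  have h3 : ((nonPermutingPairs H).ncard : ℚ) ≠ 0 := by
    exact_mod_cast ((Set.ncard_pos).2 hH).ne'
  have h4 := relSubgroupCommDegree_eq H
  have h5 := div_ne_zero h3 (mul_ne_zero h1 h2)
  have h6 : relSubgroupCommDegree H ≠ 1 := by
    rw [h4]
    intro h
    exact h5 (by linarith)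
  have h7 : 1 - v = ((nonPermutingPairs H).ncard : ℚ) /
      (((Set.Iic H).ncard : ℚ) * (Nat.card (Subgroup G) : ℚ)) := by
    rw [← hv H h6, h4]
    ring
  constructor
  · rw [h7]
    exact mul_ne_zero h5 h2
  · rw [h7]
    field_simp

/-- If the non-permuting pairs below `H` split into those below `B` and those below `C`, then in a
group of class `𝒞` the number of subgroups of `H` is the sum of those of `B` and of `C`. -/
theorem InClassC.ncard_Iic_eq_add (h : InClassC G) {H B C : Subgroup G}
    (hB : (nonPermutingPairs B).Nonempty) (hC : (nonPermutingPairs C).Nonempty)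
    (hdisj : Disjoint (nonPermutingPairs B) (nonPermutingPairs C))
    (hunion : nonPermutingPairs H = nonPermutingPairs B ∪ nonPermutingPairs C) :
    (Set.Iic H).ncard = (Set.Iic B).ncard + (Set.Iic C).ncard := by
  obtain ⟨w, hw⟩ := h.exists_ratio
  have := h.1
  obtain ⟨hw0, hB'⟩ := hw B hB
  obtain ⟨-, hC'⟩ := hw C hC
  obtain ⟨-, hH'⟩ := hw H (hunion ▸ hB.mono Set.subset_union_left)
  rw [hunion, Set.ncard_union_eq hdisj] at hH'
  push_cast at hH'
  rw [hB', hC', ← mul_add] at hH'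
  exact_mod_cast (mul_left_cancel₀ hw0 hH').symm

theorem not_inClassC_of_forall_normal (h : ∀ K : Subgroup G, K.Normal) : ¬ InClassC G := by
  rintro ⟨hfin, hcard⟩
  have h1 : (relSubgroupCommDegree : Subgroup G → ℚ) = fun _ => 1 := by
    ext H
    rw [relSubgroupCommDegree_eq, nonPermutingPairs_eq_empty fun K _ => h K]
    simp
  rw [h1, Set.range_const, Set.ncard_singleton] at hcard
  omega

end Permuting

/-! ### The two groups of order 8 -/

section DihedralAndQuaternionOfOrderEight

theorem not_inClassC_quaternionGroup_two : ¬ InClassC (QuaternionGroup 2) := by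
  refine not_inClassC_of_forall_normal fun K => ⟨fun k hk g => ?_⟩
  have : ∀ g k : QuaternionGroup 2, g * k * g⁻¹ = k ∨ g * k * g⁻¹ = k⁻¹ := by decide
  rcases this g k with h | h <;> rw [h]
  · exact hk
  · exact inv_mem hk

open DihedralGroup in
theorem not_inClassC_dihedralGroup_four : ¬ InClassC (DihedralGroup 4) := by
  intro h
  -- A Klein four-group whose only subgroups not normal in the whole group are `⟨sr 0⟩` and `⟨sr
  -- 2⟩`.
  let B : Subgroup (DihedralGroup 4) :=
    { carrier := {g | g = 1 ∨ g = r 2 ∨ g = sr 0 ∨ g = sr 2}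
      mul_mem' := by simp only [Set.mem_ofPred_eq]; decide
      one_mem' := by simp only [Set.mem_ofPred_eq]; decide
      inv_mem' := by simp only [Set.mem_ofPred_eq]; decide }
  have hB : ∀ g, g ∈ B ↔ g = 1 ∨ g = r 2 ∨ g = sr 0 ∨ g = sr 2 := fun g => Iff.rfl
  have hz : ∀ t : DihedralGroup 4, t * t = 1 → ∀ g, g ∈ Subgroup.zpowers t ↔ g = 1 ∨ g = t := by
    intro t ht g
    have ht2 : t ^ 2 = 1 := by rw [sq, ht]
    constructor
    · rintro ⟨i, rfl⟩
      obtain ⟨j, rfl | rfl⟩ := i.even_or_odd'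
      · left; simp [zpow_mul, ht2]
      · right; simp [zpow_add, zpow_mul, ht2]
    · rintro (rfl | rfl)
      · exact one_mem _
      · exact Subgroup.mem_zpowers _
  have hzr := hz (r 2) (by decide)
  have hz0 := hz (sr 0) (by decide)
  have hz2 := hz (sr 2) (by decide)
  have hIic : ∀ t : DihedralGroup 4, (∀ g, g ∈ Subgroup.zpowers t ↔ g = 1 ∨ g = t) →
      ∀ K, K ≤ Subgroup.zpowers t ↔ K = ⊥ ∨ K = Subgroup.zpowers t := by
    intro t h K
    constructor
    · intro hK
      by_cases ht : t ∈ K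
      · exact Or.inr (le_antisymm hK ((Subgroup.zpowers_le).2 ht))
      · left
        rw [Subgroup.eq_bot_iff_forall]
        intro g hg
        rcases (h g).1 (hK hg) with rfl | rfl
        · rfl
        · exact absurd hg ht
    · rintro (rfl | rfl)
      · exact bot_le
      · exact le_rfl
  have hIicB : ∀ K, K ≤ B ↔ K = ⊥ ∨ K = Subgroup.zpowers (r 2) ∨ K = Subgroup.zpowers (sr 0) ∨
      K = Subgroup.zpowers (sr 2) ∨ K = B := by
    intro K
    constructor
    · intro hK
      have h1 : r 2 ∈ K → sr 0 ∈ K → sr 2 ∈ K := fun a b => by simpa using mul_mem b a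
      have h2 : r 2 ∈ K → sr 2 ∈ K → sr 0 ∈ K := fun a b => mul_mem b a
      have h3 : sr 0 ∈ K → sr 2 ∈ K → r 2 ∈ K := fun a b => mul_mem a b
      have h4 := one_mem K
      have key : ∀ M : Subgroup (DihedralGroup 4), M ≤ B → (r 2 ∈ K ↔ r 2 ∈ M) →
          (sr 0 ∈ K ↔ sr 0 ∈ M) → (sr 2 ∈ K ↔ sr 2 ∈ M) → K = M := by
        intro M hM a b c
        ext g
        constructor
        · intro hg
          rcases (hB g).1 (hK hg) with rfl | rfl | rfl | rfl
          exacts [one_mem _, a.1 hg, b.1 hg, c.1 hg]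
        · intro hg
          rcases (hB g).1 (hM hg) with rfl | rfl | rfl | rfl
          exacts [one_mem _, a.2 hg, b.2 hg, c.2 hg]
      by_cases a : r 2 ∈ K <;> by_cases b : sr 0 ∈ K
      · right; right; right; right
        apply key <;> simp [hB, a, b, h1 a b]
      · right; left
        have c : sr 2 ∉ K := fun c => b (h2 a c)
        refine key _ (by simp [hB]) ?_ ?_ ?_ <;> rw [hzr] <;> simp [a, b, c] <;> decide
      · right; right; left
        have c : sr 2 ∉ K := fun c => a (h3 b c)
        refine key _ (by simp [hB]) ?_ ?_ ?_ <;> rw [hz0] <;> simp [a, b, c] <;> decide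
      · by_cases c : sr 2 ∈ K
        · right; right; right; left
          refine key _ (by simp [hB]) ?_ ?_ ?_ <;> rw [hz2] <;> simp [a, b, c] <;> decide
        · left
          refine key _ bot_le ?_ ?_ ?_ <;> simp [Subgroup.mem_bot, a, b, c] <;> decide
    · rintro (rfl | rfl | rfl | rfl | rfl) <;> simp [hB]
  -- `t * sr 1` is a rotation of order 4, whereas the only such rotation in `⟨sr 1⟩⟨t⟩` is its
  -- inverse.
  have hnp : ∀ t : DihedralGroup 4, (t = sr 0 ∨ t = sr 2) →
      (Subgroup.zpowers t, Subgroup.zpowers (sr 1)) ∈ nonPermutingPairs (Subgroup.zpowers t) := by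
    intro t ht
    have hz1 := hz (sr 1) (by decide)
    have hzt := hz t (by rcases ht with rfl | rfl <;> decide)
    refine ⟨le_rfl, fun heq => ?_⟩
    have hmem : t * sr 1 ∈ ((Subgroup.zpowers t : Subgroup (DihedralGroup 4)) : Set _) *
        ((Subgroup.zpowers (sr 1) : Subgroup (DihedralGroup 4)) : Set (DihedralGroup 4)) :=
      Set.mul_mem_mul (Subgroup.mem_zpowers t) (Subgroup.mem_zpowers (sr 1))
    rw [show _ * _ = _ * _ from heq] at hmem
    obtain ⟨a, ha, b, hb, hab⟩ := Set.mem_mul.1 hmem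
    rw [SetLike.mem_coe, hz1] at ha
    rw [SetLike.mem_coe, hzt] at hb
    revert hab
    rcases ht with rfl | rfl <;> rcases ha with rfl | rfl <;> rcases hb with rfl | rfl <;> decide
  have hbot : ∀ L : Subgroup (DihedralGroup 4),
      ((⊥ : Subgroup (DihedralGroup 4)) : Set (DihedralGroup 4)) * (L : Set (DihedralGroup 4)) =
        (L : Set (DihedralGroup 4)) * ((⊥ : Subgroup (DihedralGroup 4)) : Set _) :=
    fun L => Subgroup.Normal.coe_mul_comm inferInstance L
  have hcenter : (Subgroup.zpowers (r 2 : DihedralGroup 4)).Normal :=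
    ⟨fun k hk g => by
      rw [hzr] at hk ⊢
      revert g k
      decide⟩
  have hBn : B.Normal :=
    ⟨fun k hk g => by
      rw [hB] at hk ⊢
      revert g k
      decide⟩
  have hd1 : (sr 0 : DihedralGroup 4) ∈ Subgroup.zpowers (sr 0 : DihedralGroup 4) :=
    Subgroup.mem_zpowers _
  have e02 : Subgroup.zpowers (sr 0 : DihedralGroup 4) ≠ Subgroup.zpowers (sr 2) := by
    intro e
    rw [e, hz2] at hd1
    revert hd1
    decide
  have hcount := h.ncard_Iic_eq_add (H := B) ⟨_, hnp _ (Or.inl rfl)⟩ ⟨_, hnp _ (Or.inr rfl)⟩ (by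
      rw [Set.disjoint_left]
      rintro ⟨K, L⟩ ⟨h1, h1'⟩ ⟨h2, -⟩
      rcases (hIic _ hz0 K).1 h1 with rfl | rfl
      · exact h1' (hbot L)
      · rcases (hIic _ hz2 _).1 h2 with e | e
        · rw [Subgroup.zpowers_eq_bot] at e
          revert e
          decide
        · exact e02 e) (by
      ext ⟨K, L⟩
      constructor
      · rintro ⟨h1, h2⟩
        rcases (hIicB K).1 h1 with rfl | rfl | rfl | rfl | rfl
        · exact absurd (hbot L) h2
        · exact absurd (hcenter.coe_mul_comm L) h2
        · exact Or.inl ⟨le_rfl, h2⟩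
        · exact Or.inr ⟨le_rfl, h2⟩
        · exact absurd (hBn.coe_mul_comm L) h2
      · rintro (⟨h1, h2⟩ | ⟨h1, h2⟩)
        · exact ⟨h1.trans (by simp [hB]), h2⟩
        · exact ⟨h1.trans (by simp [hB]), h2⟩)
  have hle : ∀ t : DihedralGroup 4, t * t = 1 →
      (Set.Iic (Subgroup.zpowers t)).ncard ≤ 2 := by
    intro t ht2
    have : Set.Iic (Subgroup.zpowers t) = {⊥, Subgroup.zpowers t} := by
      ext K
      simp [hIic t (hz t ht2) K]
    rw [this]
    exact (Set.ncard_insert_le _ _).trans (by simp)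
  have hc0 := hle (sr 0) (by decide)
  have hc2 := hle (sr 2) (by decide)
  have : Set.Iic B = {⊥, Subgroup.zpowers (r 2), Subgroup.zpowers (sr 0),
      Subgroup.zpowers (sr 2), B} := by
    ext K
    simp [hIicB K]
  have hne' : ∀ (K M : Subgroup (DihedralGroup 4)) (t : DihedralGroup 4), t ∈ M → t ∉ K →
      K ≠ M := by
    rintro K _ t ht ht' rfl
    exact ht' ht
  -- `B` has five subgroups, but the two cyclic ones account for at most 2 + 2.
  rw [this, Set.ncard_insert_of_notMem, Set.ncard_insert_of_notMem, Set.ncard_insert_of_notMem,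
    Set.ncard_insert_of_notMem, Set.ncard_singleton] at hcount
  · omega
  · simp only [Set.mem_singleton_iff]
    exact hne' _ _ (r 2) (by simp [hB]) (by rw [hz2]; decide)
  · simp only [Set.mem_singleton_iff, Set.mem_insert_iff, not_or]
    exact ⟨e02, hne' _ _ (r 2) (by simp [hB]) (by rw [hz0]; decide)⟩
  · simp only [Set.mem_singleton_iff, Set.mem_insert_iff, not_or]
    exact ⟨hne' _ _ (sr 0) (by simp) (by rw [hzr]; decide),
      hne' _ _ (sr 2) (by simp) (by rw [hzr]; decide),
      hne' _ _ (sr 2) (by simp [hB]) (by rw [hzr]; decide)⟩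
  · simp only [Set.mem_singleton_iff, Set.mem_insert_iff, not_or]
    exact ⟨hne' _ _ (r 2) (by simp) (by rw [Subgroup.mem_bot]; decide),
      hne' _ _ (sr 0) (by simp) (by rw [Subgroup.mem_bot]; decide),
      hne' _ _ (sr 2) (by simp) (by rw [Subgroup.mem_bot]; decide),
      hne' _ _ (sr 2) (by simp [hB]) (by rw [Subgroup.mem_bot]; decide)⟩

end DihedralAndQuaternionOfOrderEight

/-! ### Groups with a cyclic subgroup of index 2 -/

section CyclicMaximal

variable {G : Type*} [Group G]

/-- Bézout: an odd exponent is invertible modulo `2 ^ k`. -/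
theorem mem_zpowers_zpow_of_odd {x : G} {k : ℕ} (hx : x ^ 2 ^ k = 1) {c : ℤ} (hc : Odd c) :
    x ∈ Subgroup.zpowers (x ^ c) := by
  have hcop : IsCoprime c ((2 : ℤ) ^ k) := by
    apply IsCoprime.pow_right
    rw [Int.isCoprime_iff_gcd_eq_one, Int.gcd_comm]
    exact Int.isCoprime_iff_gcd_eq_one.1 (Int.isCoprime_two_left.2 hc)
  obtain ⟨a, b, hab⟩ := hcop
  refine ⟨a, ?_⟩
  have hx' : x ^ ((2 : ℤ) ^ k) = 1 := by exact_mod_cast hx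
  change (x ^ c) ^ a = x
  calc (x ^ c) ^ a = x ^ (a * c + b * 2 ^ k) := by
        rw [zpow_add, mul_comm b, zpow_mul x (2 ^ k), hx', one_zpow, mul_one, ← zpow_mul, mul_comm]
    _ = x := by rw [hab, zpow_one]

/-- Conjugation by `g` acts on `⟨x⟩` as a power map, which preserves every subgroup. -/
theorem Subgroup.normal_of_le_zpowers {x : G} (hx : (Subgroup.zpowers x).Normal) {K : Subgroup G}
    (hK : K ≤ Subgroup.zpowers x) : K.Normal := by
  refine ⟨fun k hk g => ?_⟩
  obtain ⟨i, rfl⟩ := hK hk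
  obtain ⟨j, hj⟩ := hx.conj_mem x (Subgroup.mem_zpowers x) g
  have : g * x ^ i * g⁻¹ = (x ^ i) ^ j := by
    rw [← conj_zpow, ← hj, zpow_comm]
  change g * x ^ i * g⁻¹ ∈ K
  rw [this]
  exact zpow_mem hk j

/-- Let `G` be generated by `x` and `y`, with `⟨x⟩` a cyclic `2`-subgroup of index `2`, and let
`α` and `β` be the two parity characters of `G`. If `x` has order at least `8` while `y` and `x * y`
have order at most `4`, then `G` is not in the class `𝒞`. -/
theorem not_inClassC_of_parity (α β : G →* ℤˣ) {x y : G} {k : ℕ}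
    (hαx : α x = -1) (hβx : β x = 1) (hαy : α y = 1) (hβy : β y = -1)
    (hgen : ∀ g, ∃ i : ℤ, g = x ^ i ∨ g = x ^ i * y)
    (hx : x ^ 2 ^ k = 1) (hx4 : x ^ 4 ≠ 1) (hy : y ^ 4 = 1) (hxy : (x * y) ^ 4 = 1) :
    ¬ InClassC G := by
  intro h
  have := h.1
  have hneg : ∀ i : ℤ, (-1 : ℤˣ) ^ i = 1 → Even i := fun i => (Int.negOnePow_eq_one_iff i).1
  have hne : (-1 : ℤˣ) ≠ 1 := by decide
  have hA : β.ker = Subgroup.zpowers x := by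
    ext g
    rw [MonoidHom.mem_ker]
    constructor
    · intro hg
      obtain ⟨i, rfl | rfl⟩ := hgen g
      · exact ⟨i, rfl⟩
      · simp [hβx, hβy] at hg
    · rintro ⟨i, rfl⟩
      simp [hβx]
  have hAn : (Subgroup.zpowers x).Normal := hA ▸ inferInstance
  have hsub : ∀ K ≤ β.ker, K.Normal := fun K hK =>
    Subgroup.normal_of_le_zpowers hAn (hA ▸ hK)
  set Φ := α.ker ⊓ β.ker with hΦ
  set C := (α * β).ker with hC
  have memC : ∀ g, g ∈ C ↔ α g * β g = 1 := fun g => Iff.rfl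
  have hBC : α.ker ⊓ C = Φ := by
    ext g
    simp only [hΦ, Subgroup.mem_inf, MonoidHom.mem_ker, memC]
    constructor <;> rintro ⟨h1, h2⟩ <;> simp_all
  have hodd : ∀ K : Subgroup G, ∀ g ∈ K, α g = -1 → β g = 1 → β.ker ≤ K := by
    intro K g hg h1 h2
    have : g ∈ β.ker := h2
    rw [hA] at this ⊢
    obtain ⟨c, rfl⟩ := this
    have hc : Odd c := by
      rw [← Int.negOnePow_eq_neg_one_iff, Int.negOnePow_def, ← hαx, ← map_zpow]
      exact h1.trans hαx.symm
    rw [Subgroup.zpowers_le]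
    exact (Subgroup.zpowers_le.2 hg) (mem_zpowers_zpow_of_odd hx hc)
  have htop : ∀ K : Subgroup G, β.ker ≤ K → ∀ g ∈ K, β g = -1 → K = ⊤ := by
    intro K hK g hg h1
    rw [eq_top_iff]
    intro a _
    rcases Int.units_eq_one_or (β a) with h2 | h2
    · exact hK h2
    · have : a * g⁻¹ ∈ β.ker := by rw [MonoidHom.mem_ker]; simp [h1, h2]
      simpa using mul_mem (hK this) hg
  -- If `K` lies in none of the three kernels, one of `b`, `c`, `b * c` has `α = -1` and `β = 1`. It
  -- is an odd power of `x`, so `K` contains `⟨x⟩` and also `a` outside it.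
  have hcases : ∀ K : Subgroup G, K = ⊤ ∨ K = β.ker ∨ K ≤ α.ker ∨ K ≤ C := by
    intro K
    by_cases hKA : K ≤ β.ker
    · by_cases hKB : K ≤ α.ker
      · exact Or.inr (Or.inr (Or.inl hKB))
      · obtain ⟨g, hg, hg'⟩ := SetLike.not_le_iff_exists.1 hKB
        have h1 : α g = -1 := (Int.units_eq_one_or (α g)).resolve_left hg'
        exact Or.inr (Or.inl (le_antisymm hKA (hodd K g hg h1 (hKA hg))))
    · by_cases hKB : K ≤ α.ker
      · exact Or.inr (Or.inr (Or.inl hKB))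
      by_cases hKC : K ≤ C
      · exact Or.inr (Or.inr (Or.inr hKC))
      left
      obtain ⟨a, ha, ha'⟩ := SetLike.not_le_iff_exists.1 hKA
      obtain ⟨b, hb, hb'⟩ := SetLike.not_le_iff_exists.1 hKB
      obtain ⟨c, hc, hc'⟩ := SetLike.not_le_iff_exists.1 hKC
      have ha2 : β a = -1 := (Int.units_eq_one_or (β a)).resolve_left ha'
      have hb2 : α b = -1 := (Int.units_eq_one_or (α b)).resolve_left hb'
      have hc2 : ¬ α c * β c = 1 := hc'
      refine htop K ?_ a ha ha2
      rcases Int.units_eq_one_or (β b) with hb3 | hb3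
      · exact hodd K b hb hb2 hb3
      rcases Int.units_eq_one_or (α c) with hc3 | hc3
      · have hc4 : β c = -1 := (Int.units_eq_one_or (β c)).resolve_left fun e => hc2 (by simp [*])
        exact hodd K (b * c) (mul_mem hb hc) (by simp [*]) (by simp [*])
      · have hc4 : β c = 1 :=
          (Int.units_eq_one_or (β c)).resolve_right fun e => hc2 (by simp [*])
        exact hodd K c hc hc3 hc4
  -- If they permuted, `x ^ 2` would be a product of powers of `x * y` and `y`. Parity makes both
  -- exponents even, so the factors lie in `⟨x⟩`, commute and square to 1, giving `x ^ 4 = 1`.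
  have hnp : ((Subgroup.zpowers y : Subgroup G) : Set G) * (Subgroup.zpowers (x * y) : Set G) ≠
      (Subgroup.zpowers (x * y) : Set G) * (Subgroup.zpowers y : Set G) := by
    intro e
    have h1 : y⁻¹ * (x * y) ∈ ((Subgroup.zpowers y : Subgroup G) : Set G) *
        (Subgroup.zpowers (x * y) : Set G) :=
      Set.mul_mem_mul (inv_mem (Subgroup.mem_zpowers y)) (Subgroup.mem_zpowers _)
    rw [e] at h1
    obtain ⟨a, ⟨i, rfl⟩, b, ⟨j, rfl⟩, hab⟩ := Set.mem_mul.1 h1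
    change (x * y) ^ i * y ^ j = y⁻¹ * (x * y) at hab
    have h2 : x ^ 2 = (x * y) ^ (1 + i) * y ^ (j - 1) := by
      calc x ^ 2 = (x * y) * (y⁻¹ * (x * y)) * y⁻¹ := by rw [sq]; group
        _ = _ := by rw [← hab]; group
    have hi : Even (1 + i) := by
      apply hneg
      have := congrArg α h2
      simpa [hαx, hαy] using this.symm
    have hj : Even (j - 1) := by
      apply hneg
      have := congrArg β h2
      rw [map_mul, map_zpow, map_zpow, map_mul, map_pow, hβx, hβy, one_mul, hi.neg_one_zpow] at this
      simpa using this.symm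
    obtain ⟨i', hi'⟩ := hi.exists_two_nsmul
    obtain ⟨j', hj'⟩ := hj.exists_two_nsmul
    have m1 : (x * y) ^ (1 + i) ∈ Subgroup.zpowers x := by
      rw [← hA, MonoidHom.mem_ker, map_zpow, map_mul, hβx, hβy, one_mul, hi.neg_one_zpow]
    have m2 : y ^ (j - 1) ∈ Subgroup.zpowers x := by
      rw [← hA, MonoidHom.mem_ker, map_zpow, hβy, hj.neg_one_zpow]
    have hcomm : Commute ((x * y) ^ (1 + i)) (y ^ (j - 1)) := by
      obtain ⟨p, hp⟩ := m1
      obtain ⟨q, hq⟩ := m2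
      rw [← hp, ← hq]
      exact Commute.zpow_zpow_self x p q
    apply hx4
    have hp : ∀ (t : G) (m : ℤ), t ^ 4 = 1 → (t ^ (2 • m)) ^ 2 = 1 := by
      intro t m ht
      have : (t ^ (2 • m)) ^ 2 = (t ^ 4) ^ m := by
        rw [← zpow_natCast, ← zpow_natCast, ← zpow_mul, ← zpow_mul]
        congr 1
        push_cast
        ring
      rw [this, ht, one_zpow]
    calc x ^ 4 = (x ^ 2) ^ 2 := by rw [← pow_mul]
      _ = 1 := by rw [h2, hcomm.mul_pow, hi', hj', hp _ _ hxy, hp _ _ hy, mul_one]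
  have hcount := h.ncard_Iic_eq_add (H := ⊤) (B := α.ker) (C := C)
    ⟨(Subgroup.zpowers y, Subgroup.zpowers (x * y)), Subgroup.zpowers_le.2 hαy, hnp⟩
    ⟨(Subgroup.zpowers (x * y), Subgroup.zpowers y),
      Subgroup.zpowers_le.2 (by rw [memC]; simp [*]), hnp.symm⟩ (by
      rw [Set.disjoint_left]
      rintro ⟨K, L⟩ ⟨h1, h2⟩ ⟨h3, -⟩
      exact h2 ((hsub K ((le_inf h1 h3).trans (hBC.le.trans inf_le_right))).coe_mul_comm L)) (by
      ext ⟨K, L⟩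
      constructor
      · rintro ⟨-, h2⟩
        rcases hcases K with rfl | rfl | hK | hK
        · exact absurd ((inferInstance : (⊤ : Subgroup G).Normal).coe_mul_comm L) h2
        · exact absurd ((hsub _ le_rfl).coe_mul_comm L) h2
        · exact Or.inl ⟨hK, h2⟩
        · exact Or.inr ⟨hK, h2⟩
      · rintro (⟨-, h2⟩ | ⟨-, h2⟩)
        · exact ⟨le_top, h2⟩
        · exact ⟨le_top, h2⟩)
  have hnt : ∀ K : Subgroup G, x ∈ K → ¬ (K ≤ α.ker ∨ K ≤ C) := by
    rintro K hxK (hK | hK)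
    · have : α x = 1 := hK hxK
      exact hne (hαx ▸ this)
    · have := (memC x).1 (hK hxK)
      rw [hαx, hβx] at this
      exact absurd this (by decide)
  have hIic : Set.Iic (⊤ : Subgroup G) =
      insert ⊤ (insert β.ker (Set.Iic α.ker ∪ Set.Iic C)) := by
    ext K
    simpa using hcases K
  have hinter : Set.Iic α.ker ∩ Set.Iic C = Set.Iic Φ := by
    rw [Set.Iic_inter_Iic, hBC]
  have hunion := Set.ncard_union_add_ncard_inter (Set.Iic α.ker) (Set.Iic C)
  have hxA : x ∈ β.ker := hβx
  rw [hinter] at hunion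
  rw [hIic, Set.ncard_insert_of_notMem, Set.ncard_insert_of_notMem] at hcount
  -- Otherwise an odd power of `x ^ 2` is trivial, hence `x ^ 2` itself is.
  · have hx2 : x ^ 2 ∉ Subgroup.zpowers (x ^ 4) := by
      rintro ⟨j, hj⟩
      change (x ^ 4) ^ j = x ^ 2 at hj
      have hx2' : (x ^ 2) ^ 2 ^ k = 1 := by rw [← pow_mul, mul_comm, pow_mul, hx, one_pow]
      have hc : (x ^ 2) ^ (2 * j - 1) = 1 := by
        rw [zpow_sub_one, mul_inv_eq_one, zpow_mul, zpow_ofNat, ← pow_mul]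
        exact hj
      have hm := mem_zpowers_zpow_of_odd hx2' (c := 2 * j - 1) ⟨j - 1, by ring⟩
      rw [hc, Subgroup.zpowers_one_eq_bot, Subgroup.mem_bot] at hm
      apply hx4
      calc x ^ 4 = (x ^ 2) ^ 2 := by rw [← pow_mul]
        _ = 1 := by rw [hm, one_pow]
    have hmem2 : x ^ 2 ∈ Φ := by
      rw [hΦ, Subgroup.mem_inf]
      simp [MonoidHom.mem_ker, hαx, hβx]
    have hmem4 : x ^ 4 ∈ Φ := by
      have : x ^ 4 = (x ^ 2) ^ 2 := by rw [← pow_mul]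
      rw [this]
      exact pow_mem hmem2 2
    have hsub3 : {⊥, Subgroup.zpowers (x ^ 4), Subgroup.zpowers (x ^ 2)} ⊆ Set.Iic Φ := by
      rintro K (rfl | rfl | rfl)
      · exact Set.mem_Iic.2 bot_le
      · exact Set.mem_Iic.2 (Subgroup.zpowers_le.2 hmem4)
      · exact Set.mem_Iic.2 (Subgroup.zpowers_le.2 hmem2)
    have h3 := Set.ncard_le_ncard hsub3
    have e42 : Subgroup.zpowers (x ^ 4) ≠ Subgroup.zpowers (x ^ 2) :=
      fun e => hx2 (e ▸ Subgroup.mem_zpowers _)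
    rw [Set.ncard_insert_of_notMem, Set.ncard_pair e42] at h3
    · omega
    · simp only [Set.mem_insert_iff, Set.mem_singleton_iff, not_or]
      refine ⟨fun e => hx4 ?_, fun e => hx2 ?_⟩
      · exact Subgroup.zpowers_eq_bot.1 e.symm
      · rw [Subgroup.zpowers_eq_bot.1 e.symm]
        exact one_mem _
  · exact hnt _ hxA
  · rintro (e | e)
    · have : y ∈ β.ker := e ▸ Subgroup.mem_top y
      exact hne (hβy ▸ this)
    · exact hnt _ (Subgroup.mem_top x) e

end CyclicMaximal

/-! ### The three families -/

section Families

/-- The parity character of `ZMod m`, for even `m`. -/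
def zmodParity {m : ℕ} (hm : 2 ∣ m) (i : ZMod m) : ℤˣ :=
  (-1 : ℤˣ) ^ (ZMod.castHom hm (ZMod 2) i)

section zmodParity

variable {m : ℕ} (hm : 2 ∣ m)

theorem zmodParity_add (i j : ZMod m) :
    zmodParity hm (i + j) = zmodParity hm i * zmodParity hm j := by
  simp only [zmodParity, map_add, uzpow_add]

theorem zmodParity_sub (i j : ZMod m) :
    zmodParity hm (i - j) = zmodParity hm i * zmodParity hm j := by
  simp only [zmodParity, map_sub, uzpow_sub, div_eq_mul_inv, Int.units_inv_eq_self]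

theorem zmodParity_zero : zmodParity hm 0 = 1 := by
  simp only [zmodParity, map_zero, uzpow_zero]

theorem zmodParity_one : zmodParity hm 1 = -1 := by
  simp only [zmodParity, map_one, uzpow_one]

theorem zmodParity_natCast {a : ℕ} (ha : Even a) : zmodParity hm (a : ZMod m) = 1 := by
  rw [zmodParity, map_natCast, uzpow_natCast, ha.neg_one_pow]

end zmodParity

theorem natCast_four_ne_zero {m : ℕ} (h : 4 < m) : ((4 : ℕ) : ZMod m) ≠ 0 := by
  rw [Ne, ZMod.natCast_eq_zero_iff]
  exact fun hd => absurd (Nat.le_of_dvd (by norm_num) hd) (by omega)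

theorem four_lt_two_pow {k : ℕ} (hk : 3 ≤ k) : 4 < 2 ^ k :=
  lt_of_lt_of_le (by norm_num) (Nat.pow_le_pow_right (by norm_num) hk)

open DihedralGroup in
theorem not_inClassC_dihedralGroup {k : ℕ} (hk : 3 ≤ k) : ¬ InClassC (DihedralGroup (2 ^ k)) := by
  have hm : 2 ∣ 2 ^ k := dvd_pow_self 2 (by omega)
  let α : DihedralGroup (2 ^ k) →* ℤˣ := MonoidHom.mk'
    (fun g => match g with
      | r i => zmodParity hm i
      | sr i => zmodParity hm i) (by
    rintro (i | i) (j | j)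
    · simp [zmodParity_add]
    · simp [zmodParity_sub, mul_comm]
    · simp [zmodParity_add]
    · simp [zmodParity_sub, mul_comm])
  let β : DihedralGroup (2 ^ k) →* ℤˣ := MonoidHom.mk'
    (fun g => match g with
      | r _ => 1
      | sr _ => -1) (by rintro (i | i) (j | j) <;> simp)
  refine not_inClassC_of_parity α β (x := r 1) (y := sr 0) (k := k) (zmodParity_one hm) rfl
    (zmodParity_zero hm) rfl ?_ r_one_pow_n ?_ ?_ ?_
  · rintro (i | i)
    · refine ⟨i.cast, Or.inl ?_⟩
      rw [r_one_zpow, ZMod.intCast_zmod_cast]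
    -- The sign comes from `r i * sr j = sr (j - i)`.
    · refine ⟨(-i).cast, Or.inr ?_⟩
      rw [r_one_zpow, ZMod.intCast_zmod_cast, r_mul_sr]
      simp
  · rw [r_one_pow, one_def]
    exact fun h => natCast_four_ne_zero (four_lt_two_pow hk) (r.inj h)
  · rw [show 4 = 2 * 2 from rfl, pow_mul, sq (sr 0), sr_mul_self, one_pow]
  · rw [r_mul_sr, show 4 = 2 * 2 from rfl, pow_mul, sq (sr _), sr_mul_self, one_pow]

open QuaternionGroup in
theorem not_inClassC_quaternionGroup {k : ℕ} (hk : 2 ≤ k) :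
    ¬ InClassC (QuaternionGroup (2 ^ k)) := by
  have hm : 2 ∣ 2 * 2 ^ k := dvd_mul_right 2 _
  -- `xa i * xa j = a (2 ^ k + j - i)`, so `α` is multiplicative only because `2 ^ k` is even.
  have hev : zmodParity hm ((2 ^ k : ℕ) : ZMod (2 * 2 ^ k)) = 1 :=
    zmodParity_natCast hm ((Nat.even_pow.2 ⟨even_two, by omega⟩))
  let α : QuaternionGroup (2 ^ k) →* ℤˣ := MonoidHom.mk'
    (fun g => match g with
      | a i => zmodParity hm i
      | xa i => zmodParity hm i) (by
    rintro (i | i) (j | j)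
    · simp only [a_mul_a, zmodParity_add]
    · simp only [a_mul_xa, zmodParity_sub, mul_comm]
    · simp only [xa_mul_a, zmodParity_add]
    · simp only [xa_mul_xa, zmodParity_sub, zmodParity_add, hev, one_mul]
      exact mul_comm _ _)
  let β : QuaternionGroup (2 ^ k) →* ℤˣ := MonoidHom.mk'
    (fun g => match g with
      | a _ => 1
      | xa _ => -1) (by rintro (i | i) (j | j) <;> simp)
  refine not_inClassC_of_parity α β (x := a 1) (y := xa 0) (k := k + 1) (zmodParity_one hm) rfl
    (zmodParity_zero hm) rfl ?_ ?_ ?_ (xa_pow_four 0) ?_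
  · have hz : ∀ i : ZMod (2 * 2 ^ k), (a 1 : QuaternionGroup (2 ^ k)) ^ (i.val : ℤ) = a i := by
      intro i
      rw [zpow_natCast, a_one_pow, ZMod.natCast_zmod_val]
    rintro (i | i)
    · exact ⟨i.val, Or.inl (hz i).symm⟩
    · refine ⟨(-i).val, Or.inr ?_⟩
      rw [hz, a_mul_xa]
      simp
  · rw [pow_succ', a_one_pow_n]
  · rw [a_one_pow, one_def]
    refine fun h => natCast_four_ne_zero ?_ (a.inj h)
    rw [← pow_succ']
    exact four_lt_two_pow (by omega)
  · rw [a_mul_xa]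
    exact xa_pow_four _

/-- The square minus 1 is `2 ^ (n - 1) * (2 ^ (n - 3) - 1)`. This makes multiplication by the
exponent an involution. -/
theorem quasiDihedral_exponent_sq {n : ℕ} (hn : 3 ≤ n) :
    ((2 ^ (n - 2) - 1 : ℕ) : ZMod (2 ^ (n - 1))) * ((2 ^ (n - 2) - 1 : ℕ) : ZMod (2 ^ (n - 1))) =
      1 := by
  obtain ⟨k, rfl⟩ := Nat.exists_eq_add_of_le' hn
  have h : (2 : ZMod (2 ^ (k + 2))) ^ (k + 2) = 0 := by
    exact_mod_cast ZMod.natCast_self (2 ^ (k + 2))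
  change ((2 ^ (k + 1) - 1 : ℕ) : ZMod (2 ^ (k + 2))) * ((2 ^ (k + 1) - 1 : ℕ) : ZMod _) = 1
  rw [Nat.cast_sub Nat.one_le_two_pow]
  push_cast
  linear_combination (2 ^ k - 1) * h

theorem not_inClassC_quasiDihedralGroup {n : ℕ} (hn : 4 ≤ n) :
    ¬ InClassC (QuasiDihedralGroup n) := by
  set u : ℕ := 2 ^ (n - 2) - 1 with hu
  let x : QuasiDihedralGroup n := PresentedGroup.of 0
  let y : QuasiDihedralGroup n := PresentedGroup.of 1
  have hupos : 1 ≤ 2 ^ (n - 2) := Nat.one_le_two_pow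
  have heven : Even (2 ^ (n - 2)) := Nat.even_pow.2 ⟨even_two, by omega⟩
  have heven' : Even (2 ^ (n - 1)) := Nat.even_pow.2 ⟨even_two, by omega⟩
  have huodd : Odd u := Nat.Even.sub_odd hupos heven odd_one
  have hx : x ^ 2 ^ (n - 1) = 1 :=
    PresentedGroup.one_of_mem (x := FreeGroup.of 0 ^ (2 ^ (n - 1))) (Or.inl rfl)
  have hy : y ^ 2 = 1 :=
    PresentedGroup.one_of_mem (x := FreeGroup.of 1 ^ 2) (Or.inr (Or.inl rfl))
  have hrel : y⁻¹ * x * y = x ^ u :=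
    PresentedGroup.mk_eq_mk_of_mul_inv_mem (rels := quasiDihedralRels n)
      (x := (FreeGroup.of 1)⁻¹ * FreeGroup.of 0 * FreeGroup.of 1) (y := FreeGroup.of 0 ^ u)
      (Or.inr (Or.inr rfl))
  have hyinv : y⁻¹ = y := inv_eq_of_mul_eq_one_left (by rw [← sq, hy])
  have hyy : y * y = 1 := by rw [← sq, hy]
  have hsemi : SemiconjBy y x (x ^ u) := by
    rw [hyinv] at hrel
    change y * x = x ^ u * y
    rw [← hrel, mul_assoc, hyy, mul_one]
  have hlift : ∀ {H : Type} [Group H] (f : Fin 2 → H), f 0 ^ 2 ^ (n - 1) = 1 → f 1 ^ 2 = 1 →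
      (f 1)⁻¹ * f 0 * f 1 = f 0 ^ u → ∀ t ∈ quasiDihedralRels n, FreeGroup.lift f t = 1 := by
    rintro H _ f h1 h2 h3 t (rfl | rfl | rfl)
    · simpa using h1
    · simpa using h2
    · simp only [map_mul, map_inv, map_pow, FreeGroup.lift_apply_of]
      rw [mul_inv_eq_one]
      exact h3
  let α : QuasiDihedralGroup n →* ℤˣ := PresentedGroup.toGroup (f := ![-1, 1])
    (hlift _ (by simpa using heven'.neg_one_pow) (by simp) (by simpa using huodd.neg_one_pow.symm))
  let β : QuasiDihedralGroup n →* ℤˣ := PresentedGroup.toGroup (f := ![1, -1])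
    (hlift _ (by simp) (by simp) (by simp))
  have hsq := quasiDihedral_exponent_sq (n := n) (by omega)
  -- A permutation representation, with `x` a translation and `y` multiplication by `u`, shows that
  -- the relators do not force `x ^ 4 = 1`.
  let X : Equiv.Perm (ZMod (2 ^ (n - 1))) := Equiv.addRight 1
  have hinv : Function.Involutive fun t : ZMod (2 ^ (n - 1)) => (u : ZMod (2 ^ (n - 1))) * t :=
    fun t => by simp only [← mul_assoc, hu, hsq, one_mul]
  let Y : Equiv.Perm (ZMod (2 ^ (n - 1))) := hinv.toPerm
  have hX : ∀ (a : ℕ) (t), (X ^ a) t = t + a := by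
    intro a t
    induction a with
    | zero => simp
    | succ a ih =>
      rw [pow_succ', Equiv.Perm.mul_apply, ih]
      change t + a + 1 = _
      push_cast
      ring
  let ρ : QuasiDihedralGroup n →* Equiv.Perm (ZMod (2 ^ (n - 1))) :=
    PresentedGroup.toGroup (f := ![X, Y]) (hlift _ (by
      ext1 t
      change (X ^ 2 ^ (n - 1)) t = t
      rw [hX, ZMod.natCast_self, add_zero]) (by
      ext1 t
      change (u : ZMod (2 ^ (n - 1))) * (u * t) = t
      rw [← mul_assoc, hsq, one_mul]) (by
      ext1 t
      change (u : ZMod (2 ^ (n - 1))) * (u * t + 1) = (X ^ u) t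
      rw [hX, mul_add, ← mul_assoc, hsq, one_mul, mul_one]))
  refine not_inClassC_of_parity α β (x := x) (y := y) (k := n - 1)
    (PresentedGroup.toGroup.of _) (PresentedGroup.toGroup.of _) (PresentedGroup.toGroup.of _)
    (PresentedGroup.toGroup.of _) ?_ hx ?_ ?_ ?_
  · intro g
    have hg : g ∈ Subgroup.closure (Set.range (PresentedGroup.of (rels := quasiDihedralRels n))) :=
      PresentedGroup.closure_range_of (quasiDihedralRels n) ▸ Subgroup.mem_top g
    have hyx : ∀ i : ℤ, y * x ^ i = (x ^ u) ^ i * y := fun i => hsemi.zpow_right i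
    have hymul : ∀ g, (∃ i : ℤ, g = x ^ i ∨ g = x ^ i * y) →
        ∃ i : ℤ, y * g = x ^ i ∨ y * g = x ^ i * y := by
      rintro g ⟨i, rfl | rfl⟩
      · exact ⟨u * i, Or.inr (by rw [hyx, zpow_mul, zpow_natCast])⟩
      · exact ⟨u * i, Or.inl (by
          rw [← mul_assoc, hyx, zpow_mul, zpow_natCast, mul_assoc, hyy, mul_one])⟩
    have hxmul : ∀ (j : ℤ) (g), (∃ i : ℤ, g = x ^ i ∨ g = x ^ i * y) →
        ∃ i : ℤ, x ^ j * g = x ^ i ∨ x ^ j * g = x ^ i * y := by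
      rintro j g ⟨i, rfl | rfl⟩
      · exact ⟨j + i, Or.inl (zpow_add x j i).symm⟩
      · exact ⟨j + i, Or.inr (by rw [zpow_add, mul_assoc])⟩
    induction hg using Subgroup.closure_induction_left with
    | one => exact ⟨0, Or.inl (zpow_zero x).symm⟩
    | mul_left t ht g _ ih =>
      obtain ⟨i, rfl⟩ := ht
      fin_cases i
      · simpa using hxmul 1 g ih
      · exact hymul g ih
    | inv_mul_cancel t ht g _ ih =>
      obtain ⟨i, rfl⟩ := ht
      fin_cases i
      · simpa using hxmul (-1) g ih
      · change ∃ i : ℤ, y⁻¹ * g = x ^ i ∨ y⁻¹ * g = x ^ i * y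
        rw [hyinv]
        exact hymul g ih
  · intro h
    have hρ : ρ x = X := PresentedGroup.toGroup.of _
    have h0 := congrArg ρ h
    rw [map_pow, hρ, map_one] at h0
    have h1 := hX 4 0
    rw [h0, zero_add] at h1
    exact natCast_four_ne_zero (four_lt_two_pow (by omega)) h1.symm
  · rw [show 4 = 2 * 2 from rfl, pow_mul, hy, one_pow]
  -- Moving `y` past `x` gives `x * x ^ u`, and `u + 1 = 2 ^ (n - 2)`.
  · have h2 : (x * y) ^ 2 = x ^ 2 ^ (n - 2) := by
      calc (x * y) ^ 2 = x * (y * x) * y := by rw [sq]; group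
        _ = x * x ^ u * (y * y) := by rw [hsemi.eq]; group
        _ = x ^ 2 ^ (n - 2) := by rw [hyy, mul_one, ← pow_succ', hu, Nat.sub_add_cancel hupos]
    rw [show 4 = 2 * 2 from rfl, pow_mul, h2, ← pow_mul, ← pow_succ,
      show n - 2 + 1 = n - 1 by omega, hx]

end Families

/-- `DihedralGroup m` has order `2 * m` and `QuaternionGroup m` has order `4 * m`, whence the
exponents `n - 1` and `n - 2`. -/
theorem corollary3p2 :
    (∀ n : ℕ, 3 ≤ n → ¬ InClassC (DihedralGroup (2 ^ (n - 1)))) ∧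
    (∀ n : ℕ, 3 ≤ n → ¬ InClassC (QuaternionGroup (2 ^ (n - 2)))) ∧
    (∀ n : ℕ, 4 ≤ n → ¬ InClassC (QuasiDihedralGroup n)) := by
  refine ⟨fun n hn => ?_, fun n hn => ?_, fun n hn => not_inClassC_quasiDihedralGroup hn⟩
  · obtain rfl | hn' := hn.eq_or_lt
    · exact not_inClassC_dihedralGroup_four
    · exact not_inClassC_dihedralGroup (by omega)
  · obtain rfl | hn' := hn.eq_or_lt
    · exact not_inClassC_quaternionGroup_two
    · exact not_inClassC_quaternionGroup (by omega)
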